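/- **Definitions.** For $s_1,\dots,s_d\in\mathbb{N}=\{1,2,\dots\}$ and $\sigma_1,\dots,\sigma_d\in\{\pm1\}$ with $(s_1,\sigma_1)\neq(1,1)$ let $$\zeta(s_1,\dots,s_d;\sigma_1,\dots,\sigma_d)=\lim_{N\to\infty}\ \sum_{N>n_1>\cdots>n_d>0}\ \prod_{j=1}^d\frac{\sigma_j^{n_j}}{n_j^{s_j}},$$ with value $1$ for $d=0$. Write it as $\zeta(w)$ for the word $w=x_0^{s_1-1}x_{\eta_1}\cdots x_0^{s_d-1}x_{\eta_d}$ in the letters $x_0,x_1,x_{-1}$, where $\eta_j=\sigma_1\cdots\sigma_j$. Let $\zeta_{\mathrm{sh}}$ be the unique $\mathbb{Q}$-linear map from the $\mathbb{Q}$-span of the words not ending in $x_0$, with the shuffle product, to $\mathbb{R}[X]$ that is multiplicative for the shuffle product, satisfies $\zeta_{\mathrm{sh}}(w)=\zeta(w)$ for all words $w$ that neither begin with $x_1$ nor end in $x_0$ (including the empty word), and satisfies $\zeta_{\mathrm{sh}}(x_1)=X$; write $\zeta_{\mathrm{sh}}(s_1,\dots,s_d;\sigma_1,\dots,\sigma_d)=\zeta_{\mathrm{sh}}(w)$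 for the corresponding word $w$. For $\mathbf{s}=(s_1,\dots,s_d)\in\mathbb{N}^d$, $d\ge 0$, define the shuffle-regularized multiple $T$- and $S$-values $$T_{\mathrm{sh}}(\mathbf{s})=\frac1{2^d}\sum_{\sigma\in\{\pm1\}^d}\Big(\prod_{\substack{1\le j\le d\\ 2\mid d-j}}\sigma_j\Big)\zeta_{\mathrm{sh}}(\mathbf{s};\sigma),\qquad S_{\mathrm{sh}}(\mathbf{s})=\frac1{2^d}\sum_{\sigma\in\{\pm1\}^d}\Big(\prod_{\substack{1\le j\le d\\ 2\nmid d-j}}\sigma_j\Big)\zeta_{\mathrm{sh}}(\mathbf{s};\sigma),$$ and, for $F\in\{T,S\}$, the shuffle-symmetric values $$F^{\mathcal S}_{\mathrm{sh}}(\mathbf{s})=\sum_{i=0}^d(-1)^{s_1+\cdots+s_i}\,G_{\mathrm{sh}}(s_i,\dots,s_1)\,F_{\mathrm{sh}}(s_{i+1},\dots,s_d),$$ where $G=F$ if $d$ is even, and $G$ is the other one of $T,S$ if $d$ is odd. **Proposition.** In $\mathbb{R}[X]$ (so in particular independently of the regularization parameter $X=\zeta_{\mathrm{sh}}(1)$),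 $$T^{\mathcal S}_{\mathrm{sh}}(1,1,1)=-S^{\mathcal S}_{\mathrm{sh}}(1,1,1)=\frac{3}{16}\,\zeta(3).$$ -/

import Mathlib

namespace SymMTV

open Polynomial

noncomputable section

/-! ### Euler sums -/

/-- The partial sum `∑_{N > n₁ > ⋯ > n_d > 0} ∏ⱼ σⱼ ^ nⱼ / nⱼ ^ sⱼ`, for the list of pairs
`(s₁, σ₁), …, (s_d, σ_d)` with `sⱼ` a positive integer and `σⱼ = ±1`. -/
def eulerPartial : List (ℕ+ × ℤˣ) → ℕ → ℝ
  | [], _ => 1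
  | (s, σ) :: t, N =>
      ∑ n ∈ Finset.Ico 1 N, (((σ : ℤ) : ℝ) ^ n / (n : ℝ) ^ (s : ℕ)) * eulerPartial t n

/-- The Euler sum `ζ(s₁, …, s_d; σ₁, …, σ_d)`. The series need not converge absolutely, so it is
read as the limit of the partial sums over `n₁ < N`, which exists iff `(s₁, σ₁) ≠ (1, 1)`. -/
def eulerZeta (l : List (ℕ+ × ℤˣ)) : ℝ :=
  Filter.limUnder Filter.atTop (eulerPartial l)

/-! ### Words and the shuffle product -/

/-- The alphabet `x₀, x₁, x₋₁`; as differential forms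
`x₀ = dt / t`, `x₁ = dt / (1 - t)`, `x₋₁ = - dt / (1 + t)`. -/
inductive Letter where
  | x0 : Letter
  | x1 : Letter
  | xm1 : Letter

abbrev Word := List Letter

/-- The list (with multiplicity) of all shuffles of two words. -/
def shuffle : Word → Word → List Word
  | [], v => [v]
  | u, [] => [u]
  | a :: u, b :: v =>
      (shuffle u (b :: v)).map (fun w => a :: w) ++ (shuffle (a :: u) v).map (fun w => b :: w)

/-- The letter `x_η` for `η = ±1`. -/
def letterOf (η : ℤˣ) : Letter := if η = 1 then .x1 else .xm1

/-- `encode ε` sends `(s₁, σ₁), …, (s_d, σ_d)` to the word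
`x₀^{s₁-1} x_{η₁} ⋯ x₀^{s_d-1} x_{η_d}`, where `ηⱼ = ε σ₁ ⋯ σⱼ`. -/
def encode : ℤˣ → List (ℕ+ × ℤˣ) → Word
  | _, [] => []
  | ε, (s, σ) :: t =>
      List.replicate ((s : ℕ) - 1) Letter.x0 ++ letterOf (ε * σ) :: encode (ε * σ) t

/-- The inverse of `encode` on words not ending with `x₀`: `decode ε k w` reads off `(sⱼ, σⱼ)`
with `σⱼ = ηⱼ / ηⱼ₋₁`, where `η₀ = ε`; `k` counts the letters `x₀` read since the last `x_{±1}`. -/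
def decode : ℤˣ → ℕ → Word → List (ℕ+ × ℤˣ)
  | _, _, [] => []
  | ε, k, .x0 :: w => decode ε (k + 1) w
  | ε, k, .x1 :: w => (k.succPNat, 1 / ε) :: decode 1 0 w
  | ε, k, .xm1 :: w => (k.succPNat, -1 / ε) :: decode (-1) 0 w

/-- The Euler sum attached to a word. -/
def zetaWord (w : Word) : ℝ := eulerZeta (decode 1 0 w)

/-! ### Shuffle regularization -/

/-- The words `y w'`, where `v = y v'` and `w'` runs through the shuffles of `x₁` and `v'`. -/
def insertTail : Word → List Word
  | [] => []
  | y :: v => (shuffle [.x1] v).map (fun w => y :: w)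

/-- The regularized value of `x₁ⁿ v`, where `v` does not begin with `x₁`. It is obtained from
`x₁ ⧢ (x₁ⁿ v) = (n + 1) x₁ⁿ⁺¹ v + ∑_{v' ∈ insertTail v} x₁ⁿ v'`. -/
def regAux : ℕ → Word → ℝ[X]
  | 0, v => C (zetaWord v)
  | n + 1, v =>
      C (1 / ((n : ℝ) + 1)) * (X * regAux n v - ((insertTail v).map (regAux n)).sum)

/-- `regFrom n w` is the regularized value of `x₁ⁿ w`. -/
def regFrom : ℕ → Word → ℝ[X]
  | n, .x1 :: w => regFrom (n + 1) w
  | n, w => regAux n w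

/-- The shuffle-regularized value of a word, a polynomial in the variable `X = ζ_⧢(1)`. On words
not ending with `x₀` it is the only possible shuffle homomorphism that extends the convergent
Euler sums and maps `x₁` to `X`: see `zetaShWord_shuffle` and `zetaShWord_unique`. -/
def zetaShWord (w : Word) : ℝ[X] := regFrom 0 w

/-- The shuffle-regularized Euler sum `ζ_⧢(s₁, …, s_d; σ₁, …, σ_d)`. -/
def zetaSh (l : List (ℕ+ × ℤˣ)) : ℝ[X] := zetaShWord (encode 1 l)

/-! ### Multiple `T`- and `S`-values and their symmetric versions -/

inductive Kind where
  | T : Kind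
  | S : Kind

/-- `F ↦ S + T - F`. -/
def Kind.swap : Kind → Kind
  | .T => .S
  | .S => .T

/-- The sign `∏_{1 ≤ j ≤ d, 2 ∣ d - j} σⱼ` for `T`, and `∏_{1 ≤ j ≤ d, 2 ∤ d - j} σⱼ` for `S`
(the index `j : Fin d` stands for `j + 1`). -/
def Kind.sign (F : Kind) {d : ℕ} (σ : Fin d → ℤˣ) : ℤˣ :=
  match F with
  | .T => ∏ j : Fin d, if Even (d - ((j : ℕ) + 1)) then σ j else 1
  | .S => ∏ j : Fin d, if Odd (d - ((j : ℕ) + 1)) then σ j else 1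

/-- The shuffle-regularized multiple `T`-value or `S`-value `F_⧢(s)`. -/
def regValue (F : Kind) (s : List ℕ+) : ℝ[X] :=
  C (1 / 2 ^ s.length) * ∑ σ : Fin s.length → ℤˣ,
    C (((F.sign σ : ℤˣ) : ℤ) : ℝ) * zetaSh (List.ofFn fun j => (s.get j, σ j))

/-- The shuffle-symmetric multiple `T`-value or `S`-value: the sum over `0 ≤ i ≤ d` of
`(-1)^{s₁+⋯+s_i} G_⧢(s_i, …, s₁) F_⧢(s_{i+1}, …, s_d)`, where `G = F` if `d` is even, and `G` is
the other kind if `d` is odd. -/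
def symValue (F : Kind) (s : List ℕ+) : ℝ[X] :=
  ∑ i ∈ Finset.range (s.length + 1),
    ((s.take i).map fun a => (-1 : ℝ[X]) ^ (a : ℕ)).prod *
      regValue (if Even s.length then F else F.swap) (s.take i).reverse *
      regValue F (s.drop i)

/-! ### The regularization is the one determined by the shuffle product -/

theorem shuffle_x1_nil : shuffle [.x1] [] = [[.x1]] := by simp [shuffle]

theorem shuffle_x1_cons (b : Letter) (v : Word) :
    shuffle [.x1] (b :: v) =
      (.x1 :: b :: v) :: (shuffle [.x1] v).map (fun w => b :: w) := by
  simp [shuffle]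

theorem regAux_succ (n : ℕ) (v : Word) :
    ((n : ℝ[X]) + 1) * regAux (n + 1) v + ((insertTail v).map (regAux n)).sum =
      X * regAux n v := by
  have h : ((n : ℝ[X]) + 1) * C (1 / ((n : ℝ) + 1)) = 1 := by
    have h1 : ((n : ℝ[X]) + 1) = C ((n : ℝ) + 1) := by simp
    rw [h1, ← C_mul, mul_one_div_cancel (by positivity), C_1]
  rw [regAux, ← mul_assoc, h, one_mul, sub_add_cancel]

theorem regFrom_shuffle (u : Word) (k : ℕ) :
    (k : ℝ[X]) * regFrom k (.x1 :: u) + ((shuffle [.x1] u).map (regFrom k)).sum =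
      X * regFrom k u := by
  induction u generalizing k with
  | nil =>
    have := regAux_succ k []
    simp only [insertTail, List.map_nil, List.sum_nil] at this
    simp only [shuffle_x1_nil, regFrom, List.map_cons, List.map_nil, List.sum_cons, List.sum_nil]
    linear_combination this
  | cons b v ih =>
    rw [shuffle_x1_cons, List.map_cons, List.sum_cons, List.map_map]
    cases b with
    | x1 =>
      have := ih (k + 1)
      push_cast at this
      have e : (regFrom k ∘ fun w => Letter.x1 :: w) = regFrom (k + 1) := by
        funext w; simp [regFrom]
      rw [e]
      simp only [regFrom] at this ⊢
      linear_combination this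
    | x0 =>
      have := regAux_succ k (.x0 :: v)
      have e : (regFrom k ∘ fun w => Letter.x0 :: w) = regAux k ∘ fun w => Letter.x0 :: w := by
        funext w; simp [regFrom]
      rw [e]
      simp only [insertTail, List.map_map] at this
      simp only [regFrom]
      linear_combination this
    | xm1 =>
      have := regAux_succ k (.xm1 :: v)
      have e : (regFrom k ∘ fun w => Letter.xm1 :: w) = regAux k ∘ fun w => Letter.xm1 :: w := by
        funext w; simp [regFrom]
      rw [e]
      simp only [insertTail, List.map_map] at this
      simp only [regFrom]
      linear_combination this

/-- `ζ_⧢(x₁ ⧢ u) = X ζ_⧢(u)`. -/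
theorem zetaShWord_shuffle (u : Word) :
    ((shuffle [.x1] u).map zetaShWord).sum = X * zetaShWord u := by
  have := regFrom_shuffle u 0
  have e : zetaShWord = regFrom 0 := rfl
  simpa [e] using this

/-- `ζ_⧢` extends the Euler sums of the words not beginning with `x₁`. -/
theorem zetaShWord_admissible (v : Word) (hv : v.head? ≠ some .x1) :
    zetaShWord v = C (zetaWord v) := by
  rcases v with _ | ⟨_ | _ | _, v⟩ <;> simp_all [zetaShWord, regFrom, regAux]

theorem shuffle_x1_getLast (u : Word) (hu : u.getLast? ≠ some .x0) :
    ∀ w ∈ shuffle [.x1] u, w.getLast? ≠ some .x0 := by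
  induction u with
  | nil => simp [shuffle_x1_nil]
  | cons b v ih =>
    intro w hw
    rw [shuffle_x1_cons, List.mem_cons, List.mem_map] at hw
    rcases hw with rfl | ⟨w, hw, rfl⟩
    · simpa [List.getLast?_cons] using hu
    · have hne : w ≠ [] := by
        rintro rfl
        cases v <;> simp [shuffle_x1_nil, shuffle_x1_cons] at hw
      rcases v with _ | ⟨c, v⟩
      · simp only [shuffle_x1_nil, List.mem_singleton] at hw
        subst hw
        simp
      · have := ih (by simpa [List.getLast?_cons] using hu) w hw
        obtain ⟨d, w, rfl⟩ := List.exists_cons_of_ne_nil hne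
        simpa [List.getLast?_cons] using this

theorem unique_regAux (Z : Word → ℝ[X])
    (h0 : ∀ v : Word, v.getLast? ≠ some .x0 → v.head? ≠ some .x1 → Z v = C (zetaWord v))
    (h1 : ∀ u : Word, u.getLast? ≠ some .x0 →
      ((shuffle [.x1] u).map Z).sum = X * Z u)
    (n : ℕ) : ∀ v : Word, v.getLast? ≠ some .x0 → v.head? ≠ some .x1 →
      Z (List.replicate n .x1 ++ v) = regAux n v := by
  have key (n : ℕ) (v : Word) (hv : v.head? ≠ some .x1) (Z : Word → ℝ[X]) :
      ((shuffle [.x1] (List.replicate n .x1 ++ v)).map Z).sum =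
        ((n : ℝ[X]) + 1) * Z (List.replicate (n + 1) .x1 ++ v) +
          ((insertTail v).map fun w => Z (List.replicate n .x1 ++ w)).sum := by
    induction n generalizing Z with
    | zero => cases v <;> simp [shuffle_x1_nil, shuffle_x1_cons, insertTail]
    | succ n ih =>
      have := ih (fun w => Z (.x1 :: w))
      simp only [List.replicate_succ, List.cons_append, shuffle_x1_cons, List.map_cons,
        List.sum_cons, List.map_map, Function.comp_def] at this ⊢
      push_cast
      linear_combination this
  induction n with
  | zero => intro v hv hv'; simpa [regAux] using h0 v hv hv'
  | succ n ih =>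
    intro v hv hv'
    have hl : (List.replicate n Letter.x1 ++ v).getLast? ≠ some .x0 := by
      rcases v.eq_nil_or_concat with rfl | ⟨v, a, rfl⟩
      · cases n <;> simp [List.getLast?_replicate]
      · simpa [List.getLast?_append] using hv
    have e := h1 _ hl
    rw [key n v hv' Z, ih v hv hv', ← regAux_succ] at e
    have e2 : ((insertTail v).map fun w => Z (List.replicate n .x1 ++ w)) =
        (insertTail v).map (regAux n) := by
      refine List.map_congr_left fun w hw => ?_
      rcases v with _ | ⟨b, v⟩
      · simp [insertTail] at hw
      · refine ih w (shuffle_x1_getLast (b :: v) hv w ?_) ?_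
        · rw [shuffle_x1_cons]
          exact List.mem_cons_of_mem _ hw
        · simp only [insertTail, List.mem_map] at hw
          obtain ⟨w, _, rfl⟩ := hw
          simpa using hv'
    rw [e2] at e
    have hn : ((n : ℝ[X]) + 1) ≠ 0 := by exact_mod_cast Nat.succ_ne_zero n
    exact mul_left_cancel₀ hn (add_right_cancel e)

/-- On the words not ending with `x₀`, `zetaShWord` is the only map that extends the convergent
Euler sums and satisfies `Z(x₁ ⧢ u) = X Z(u)`. -/
theorem zetaShWord_unique (Z : Word → ℝ[X])
    (h0 : ∀ v : Word, v.getLast? ≠ some .x0 → v.head? ≠ some .x1 → Z v = C (zetaWord v))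
    (h1 : ∀ u : Word, u.getLast? ≠ some .x0 →
      ((shuffle [.x1] u).map Z).sum = X * Z u)
    (w : Word) (hw : w.getLast? ≠ some .x0) : Z w = zetaShWord w := by
  have split (w : Word) : ∃ (n : ℕ) (v : Word), w = List.replicate n .x1 ++ v ∧
      v.head? ≠ some .x1 := by
    induction w with
    | nil => exact ⟨0, [], by simp⟩
    | cons b w ih =>
      obtain ⟨n, v, rfl, hv⟩ := ih
      cases b with
      | x1 => exact ⟨n + 1, v, by simp [List.replicate_succ], hv⟩
      | x0 => exact ⟨0, .x0 :: (List.replicate n .x1 ++ v), by simp⟩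
      | xm1 => exact ⟨0, .xm1 :: (List.replicate n .x1 ++ v), by simp⟩
  obtain ⟨n, v, rfl, hv⟩ := split w
  have hl : v.getLast? ≠ some .x0 := by
    rcases v.eq_nil_or_concat with rfl | ⟨v, a, rfl⟩
    · simp
    · simpa [List.getLast?_append] using hw
  rw [unique_regAux Z h0 h1 n v hl hv,
    unique_regAux zetaShWord (fun v _ h => zetaShWord_admissible v h)
      (fun u _ => zetaShWord_shuffle u) n v hl hv]

end

end SymMTV

/-!
Write `a = x₁`, `b = x₋₁` and `p = (a - b) / 2`, `q = (a + b) / 2`. Since `σⱼ = ηⱼ / ηⱼ₋₁`, the signs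
in the definitions of the `T`- and `S`-values turn them into the regularized values of words in `p`
and `q`: with all arguments `1`, the `T`-value is the word `p ⋯ p p` and the `S`-value is
`p ⋯ p q`. Hence `T^S(1, 1, 1) = ppp - q ⧢ pp + pq ⧢ p - ppq`, and the shuffle product leaves
`ppp - qpp = -bpp`. The words of `bpp` do not begin with `x₁`, so its value does not depend on `X`.
Exchanging `T` and `S` changes the sign of the whole expression.

The products with `x₁` are part of the regularization, and `b ⧢ aa = baa + aba + aab` follows from
them, because `2 aa = a ⧢ a`. The only other product that is needed is `b ⧢ ba = 2 bba + bab`, an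
identity of convergent Euler sums (`zetaWord_mul_shuffle`). The cancellation is carried out in
`zetaShWord_symmetric_sum`.

The analytic facts are proved with the multiple polylogarithms of words in `x_{±1}`, as power series
on `(-1, 1)`. They satisfy the differential equation of iterated integrals
(`hasDerivAt_multiPolylog`), so identities between them are checked by differentiation. For a word
that begins with `x₋₁` the Euler sum is an alternating series whose coefficients have bounded
variation, hence it converges, and by Abel's theorem it is the limit of the polylogarithm at `1`
(`tendsto_multiPolylog`).

Finally `-ζ(bpp) = ∫₀¹ L(t)² / (8 (1 + t)) dt` with `L(t) = log ((1 + t) / (1 - t))`, and the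
substitution `s = (1 - t) / (1 + t)` turns this into `∫₀¹ log² s / (8 (1 + s)) ds`. An explicit
primitive in terms of `Li₂(-s)` and `Li₃(-s)` gives `-Li₃(-1) / 4 = 3/16 ζ(3)`
(`zetaWord_xm1_sub_sub`).
-/

namespace SymMTV

open Polynomial Filter Topology

/-! ### Power series and alternating series -/

/-- Termwise differentiation on `(-1, 1)` of a power series with bounded coefficients. -/
theorem hasDerivAt_tsum_mul_pow {a : ℕ → ℝ} {C : ℝ} (ha : ∀ n, |a n| ≤ C) {x : ℝ} (hx : |x| < 1) :
    HasDerivAt (fun y => ∑' n, a n * y ^ n) (∑' n : ℕ, ((n : ℝ) + 1) * a (n + 1) * x ^ n) x := by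
  obtain ⟨r, hxr, hr⟩ := exists_between hx
  have hr0 : 0 < r := (abs_nonneg x).trans_lt hxr
  have hu : Summable fun n : ℕ => C * (n * r ^ (n - 1)) := by
    refine Summable.mul_left C ?_
    rw [← summable_nat_add_iff 1]
    have h1 := summable_pow_mul_geometric_of_norm_lt_one (R := ℝ) 1 (r := r)
      (by rwa [Real.norm_of_nonneg hr0.le])
    have h0 := summable_pow_mul_geometric_of_norm_lt_one (R := ℝ) 0 (r := r)
      (by rwa [Real.norm_of_nonneg hr0.le])
    refine (h1.add h0).congr fun n => ?_
    push_cast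
    simp
    ring
  have hd : ∀ (n : ℕ) (y : ℝ), y ∈ Metric.ball (0 : ℝ) r →
      HasDerivAt (fun y => a n * y ^ n) (a n * (n * y ^ (n - 1))) y :=
    fun n y _ => (hasDerivAt_pow n y).const_mul (a n)
  have hb : ∀ (n : ℕ) (y : ℝ), y ∈ Metric.ball (0 : ℝ) r →
      ‖a n * (n * y ^ (n - 1))‖ ≤ C * (n * r ^ (n - 1)) := by
    intro n y hy
    rw [mem_ball_zero_iff, Real.norm_eq_abs] at hy
    rw [Real.norm_eq_abs, abs_mul, abs_mul, abs_pow, Nat.abs_cast]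
    gcongr
    · exact (abs_nonneg _).trans (ha n)
    · exact ha n
  have hx' : x ∈ Metric.ball (0 : ℝ) r := by simpa using hxr
  have h0 : Summable fun n => a n * (0 : ℝ) ^ n :=
    summable_of_ne_finset_zero (s := {0}) fun n hn => by
      rw [zero_pow (by simpa using hn), mul_zero]
  have key := hasDerivAt_tsum_of_isPreconnected hu Metric.isOpen_ball
    (convex_ball (0 : ℝ) r).isPreconnected hd hb (Metric.mem_ball_self hr0) h0 hx'
  have hs : Summable fun n : ℕ => a n * (n * x ^ (n - 1)) :=
    Summable.of_norm_bounded hu fun n => hb n x hx'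
  refine key.congr_deriv ?_
  rw [hs.tsum_eq_zero_add]
  simp only [Nat.cast_zero, zero_mul, mul_zero, zero_add, Nat.add_sub_cancel, Nat.cast_add,
    Nat.cast_one]
  exact tsum_congr fun n => by ring

/-- An alternating series converges if its coefficients tend to `0` and have bounded variation. -/
theorem exists_tendsto_sum_neg_one_pow_mul {a : ℕ → ℝ} (h0 : Tendsto a atTop (𝓝 0))
    (ha : Summable fun n => |a n - a (n + 1)|) :
    ∃ z, Tendsto (fun N => ∑ n ∈ Finset.range N, (-1) ^ n * a n) atTop (𝓝 z) := by
  have hs : Summable fun n => (-1 : ℝ) ^ n * (a n - a (n + 1)) :=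
    Summable.of_norm (ha.congr fun n => by simp)
  -- add the series to its own shift: twice the sum telescopes into absolutely convergent terms
  have hN : ∀ N, ∑ n ∈ Finset.range N, (-1) ^ n * a n =
      (a 0 - (-1) ^ N * a N + ∑ n ∈ Finset.range N, (-1) ^ n * (a n - a (n + 1))) / 2 := by
    intro N
    induction N with
    | zero => simp
    | succ N ih => rw [Finset.sum_range_succ, Finset.sum_range_succ, ih]; ring
  have hb : Tendsto (fun N => (-1 : ℝ) ^ N * a N) atTop (𝓝 0) := by
    rw [tendsto_zero_iff_abs_tendsto_zero] at h0 ⊢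
    exact h0.congr fun n => by simp [abs_mul]
  exact ⟨_, (((tendsto_const_nhds.sub hb).add hs.hasSum.tendsto_sum_nat).div_const 2).congr
    fun N => (hN N).symm⟩

/-! ### Growth of the partial sums and convergence -/

theorem abs_unit_pow (σ : ℤˣ) (n : ℕ) : |((σ : ℤ) : ℝ) ^ n| = 1 := by
  rcases Int.units_eq_one_or σ with rfl | rfl <;> simp

theorem eulerPartial_cons (s : ℕ+) (σ : ℤˣ) (t : List (ℕ+ × ℤˣ)) (N : ℕ) :
    eulerPartial ((s, σ) :: t) N =
      ∑ n ∈ Finset.range N, (((σ : ℤ) : ℝ) ^ n / (n : ℝ) ^ (s : ℕ)) * eulerPartial t n := by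
  rcases N with _ | N
  · simp [eulerPartial]
  · rw [eulerPartial, Finset.range_eq_Ico, Finset.sum_eq_sum_Ico_succ_bot (Nat.succ_pos N)]
    simp

theorem eulerPartial_cons_succ (s : ℕ+) (σ : ℤˣ) (t : List (ℕ+ × ℤˣ)) (N : ℕ) :
    eulerPartial ((s, σ) :: t) (N + 1) = eulerPartial ((s, σ) :: t) N +
      (((σ : ℤ) : ℝ) ^ N / (N : ℝ) ^ (s : ℕ)) * eulerPartial t N := by
  rw [eulerPartial_cons, eulerPartial_cons, Finset.sum_range_succ]

theorem abs_eulerPartial_le (l : List (ℕ+ × ℤˣ)) (n : ℕ) (hn : 1 ≤ n) :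
    |eulerPartial l n| ≤ 3 ^ l.length * √n := by
  induction l generalizing n with
  | nil => simpa [eulerPartial] using hn
  | cons p t ih =>
    obtain ⟨s, σ⟩ := p
    induction n, hn using Nat.le_induction with
    | base => simp [eulerPartial]
    | succ n hn ihn =>
      rw [eulerPartial_cons_succ]
      have hn' : (1 : ℝ) ≤ n := by exact_mod_cast hn
      have hn0 : (0 : ℝ) < n := by linarith
      have ha : 0 < √(n : ℝ) := Real.sqrt_pos.2 hn0
      have ha2 : √(n : ℝ) ^ 2 = n := Real.sq_sqrt hn0.le
      have hb2 : √((n : ℝ) + 1) ^ 2 = n + 1 := Real.sq_sqrt (by linarith)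
      have hab : √(n : ℝ) ≤ √((n : ℝ) + 1) := Real.sqrt_le_sqrt (by linarith)
      have hb : √((n : ℝ) + 1) ≤ 2 * √(n : ℝ) := by
        rw [Real.sqrt_le_left (by positivity), mul_pow, ha2]; linarith
      have h1 : |((σ : ℤ) : ℝ) ^ n / (n : ℝ) ^ (s : ℕ) * eulerPartial t n| ≤
          3 ^ t.length / √(n : ℝ) := by
        rw [abs_mul, abs_div, abs_unit_pow, abs_of_nonneg (by positivity : (0 : ℝ) ≤ n ^ (s : ℕ))]
        have : (1 : ℝ) / n ^ (s : ℕ) ≤ 1 / n :=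
          one_div_le_one_div_of_le hn0 (le_self_pow₀ hn' s.ne_zero)
        calc 1 / (n : ℝ) ^ (s : ℕ) * |eulerPartial t n| ≤ 1 / n * (3 ^ t.length * √n) := by
              gcongr; exact ih n hn
          _ = 3 ^ t.length / √(n : ℝ) := by
              field_simp; rw [ha2]
      -- `1 / √n ≤ 3 (√(n+1) - √n)`
      have h2 : 1 / √(n : ℝ) ≤ 3 * (√((n : ℝ) + 1) - √n) := by
        rw [div_le_iff₀ ha]
        nlinarith
      have h3 : (0 : ℝ) < 3 ^ t.length := by positivity
      have h4 := mul_le_mul_of_nonneg_left h2 h3.le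
      refine (abs_add_le _ _).trans ?_
      rw [List.length_cons, pow_succ] at ihn ⊢
      push_cast
      rw [mul_one_div] at h4
      linarith

theorem abs_eulerPartial_div_le (l : List (ℕ+ × ℤˣ)) (n : ℕ) :
    |eulerPartial l n / n| ≤ 3 ^ l.length := by
  rcases Nat.eq_zero_or_pos n with rfl | hn
  · simp
  · have hn' : (1 : ℝ) ≤ n := by exact_mod_cast hn
    rw [abs_div, Nat.abs_cast, div_le_iff₀ (by linarith)]
    refine (abs_eulerPartial_le l n hn).trans ?_
    gcongr
    exact Real.sqrt_le_self_iff.2 (Or.inr hn')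

theorem sqrt_div_sq_eq (n : ℕ) : √(n : ℝ) / n ^ 2 = ((n : ℝ) ^ (3 / 2 : ℝ))⁻¹ := by
  rcases Nat.eq_zero_or_pos n with rfl | hn
  · norm_num
  · have hn0 : (0 : ℝ) < n := by exact_mod_cast hn
    rw [Real.sqrt_eq_rpow, ← Real.rpow_natCast, ← Real.rpow_sub hn0, ← Real.rpow_neg hn0.le]
    norm_num

theorem tendsto_eulerPartial_div (l : List (ℕ+ × ℤˣ)) :
    Tendsto (fun n : ℕ => eulerPartial l n / n) atTop (𝓝 0) := by
  have h : Tendsto (fun n : ℕ => (3 : ℝ) ^ l.length * (√(n : ℝ))⁻¹) atTop (𝓝 0) := by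
    have := (Real.tendsto_sqrt_atTop.comp tendsto_natCast_atTop_atTop).inv_tendsto_atTop
    simpa using this.const_mul ((3 : ℝ) ^ l.length)
  refine squeeze_zero_norm' ?_ h
  filter_upwards [eventually_ge_atTop 1] with n hn
  have hn0 : (0 : ℝ) < n := by exact_mod_cast hn
  have hs : √(n : ℝ) * √n = n := Real.mul_self_sqrt hn0.le
  have ha : 0 < √(n : ℝ) := Real.sqrt_pos.2 hn0
  rw [Real.norm_eq_abs, abs_div, Nat.abs_cast, div_le_iff₀ hn0, mul_assoc]
  have : (√(n : ℝ))⁻¹ * n = √n := by field_simp; linarith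
  rw [this]
  exact abs_eulerPartial_le l n hn

theorem summable_variation_eulerPartial_div (l : List (ℕ+ × ℤˣ)) :
    Summable fun n : ℕ => |eulerPartial l n / n - eulerPartial l (n + 1) / (n + 1 : ℕ)| := by
  have hb : Summable fun n : ℕ => (3 : ℝ) ^ l.length * (2 * (√(n : ℝ) / n ^ 2)) := by
    refine Summable.mul_left _ (Summable.mul_left _ ?_)
    simp only [sqrt_div_sq_eq]
    exact Real.summable_nat_rpow_inv.2 (by norm_num)
  refine Summable.of_norm_bounded_eventually_nat hb ?_
  filter_upwards [eventually_ge_atTop 1] with n hn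
  have hn' : (1 : ℝ) ≤ n := by exact_mod_cast hn
  have hn0 : (0 : ℝ) < n := by linarith
  have ha : 0 ≤ √(n : ℝ) := Real.sqrt_nonneg _
  have h1 := abs_eulerPartial_le l n hn
  have h2 : |eulerPartial l (n + 1) - eulerPartial l n| ≤ 3 ^ l.length * √n / n := by
    rcases l with _ | ⟨⟨s, σ⟩, t⟩
    · simp [eulerPartial]; positivity
    · rw [eulerPartial_cons_succ, add_sub_cancel_left, abs_mul, abs_div, abs_unit_pow,
        abs_of_nonneg (by positivity : (0 : ℝ) ≤ n ^ (s : ℕ))]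
      have h3 : (1 : ℝ) / n ^ (s : ℕ) ≤ 1 / n :=
        one_div_le_one_div_of_le hn0 (le_self_pow₀ hn' s.ne_zero)
      have h4 := abs_eulerPartial_le t n hn
      calc 1 / (n : ℝ) ^ (s : ℕ) * |eulerPartial t n| ≤ 1 / n * (3 ^ t.length * √n) := by gcongr
        _ ≤ 1 / n * (3 ^ (t.length + 1) * √n) := by gcongr <;> norm_num
        _ = _ := by rw [List.length_cons]; ring
  rw [Real.norm_eq_abs, abs_abs]
  have e : eulerPartial l n / n - eulerPartial l (n + 1) / (n + 1 : ℕ) =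
      eulerPartial l n / (n * (n + 1)) -
        (eulerPartial l (n + 1) - eulerPartial l n) / (n + 1) := by
    push_cast
    field_simp
    ring
  rw [e]
  have h5 : |eulerPartial l n / (n * (n + 1))| ≤ 3 ^ l.length * √n / (n * n) := by
    rw [abs_div, abs_of_pos (by positivity : (0 : ℝ) < n * (n + 1))]
    gcongr
    linarith
  have h6 : |(eulerPartial l (n + 1) - eulerPartial l n) / (n + 1)| ≤
      3 ^ l.length * √n / n / n := by
    rw [abs_div, abs_of_pos (by positivity : (0 : ℝ) < n + 1)]
    gcongr
    linarith
  refine (abs_sub _ _).trans ((add_le_add h5 h6).trans (le_of_eq ?_))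
  field_simp
  ring

/-- The Euler sum `ζ(1, s₂, …, s_d; -1, σ₂, …, σ_d)` converges. -/
theorem tendsto_eulerPartial_one_neg_one (t : List (ℕ+ × ℤˣ)) :
    Tendsto (eulerPartial ((1, -1) :: t)) atTop (𝓝 (eulerZeta ((1, -1) :: t))) := by
  refine tendsto_nhds_limUnder ?_
  obtain ⟨z, hz⟩ := exists_tendsto_sum_neg_one_pow_mul (tendsto_eulerPartial_div t)
    (summable_variation_eulerPartial_div t)
  refine ⟨z, hz.congr fun N => ?_⟩
  rw [eulerPartial_cons]
  refine Finset.sum_congr rfl fun n _ => ?_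
  simp
  ring

/-! ### Multiple polylogarithms -/

/-- The pairs `(1, σⱼ)` with `σⱼ = ηⱼ / ηⱼ₋₁` and `η₀ = ε`, for the word `x_{η₁} ⋯ x_{η_d}`. -/
def unitPairs : ℤˣ → List ℤˣ → List (ℕ+ × ℤˣ)
  | _, [] => []
  | ε, η :: t => (1, ε * η) :: unitPairs η t

theorem decode_map_letterOf (ε : ℤˣ) (w : List ℤˣ) :
    decode ε 0 (w.map letterOf) = unitPairs ε w := by
  induction w generalizing ε with
  | nil => rfl
  | cons η t ih =>
    rcases Int.units_eq_one_or ε with rfl | rfl <;> rcases Int.units_eq_one_or η with rfl | rfl <;>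
      simp [decode, unitPairs, letterOf, ih] <;> rfl

/-- The one-variable multiple polylogarithm of the word `x_{η₁} ⋯ x_{η_d}`, that is the iterated
integral of this word from `0` to `x`, as a power series in `x`. The constant term is `0` for
`d > 0`, since `1 / 0 = 0`. -/
noncomputable def multiPolylog : List ℤˣ → ℝ → ℝ
  | [], _ => 1
  | η :: t, x => ∑' n : ℕ, ((η : ℤ) : ℝ) ^ n / n * eulerPartial (unitPairs η t) n * x ^ n

theorem multiPolylog_zero (η : ℤˣ) (t : List ℤˣ) : multiPolylog (η :: t) 0 = 0 := by
  rw [multiPolylog, ← tsum_zero (α := ℝ) (β := ℕ)]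
  refine tsum_congr fun n => ?_
  rcases n with _ | n <;> simp

theorem summable_multiPolylog (η : ℤˣ) (t : List ℤˣ) {x : ℝ} (hx : |x| < 1) :
    Summable fun n : ℕ => ((η : ℤ) : ℝ) ^ n / n * eulerPartial (unitPairs η t) n * x ^ n := by
  refine Summable.of_norm_bounded
    ((summable_geometric_of_lt_one (abs_nonneg x) hx).mul_left (3 ^ (unitPairs η t).length))
    fun n => ?_
  have := abs_eulerPartial_div_le (unitPairs η t) n
  rw [Real.norm_eq_abs, abs_mul, abs_pow, div_mul_eq_mul_div, mul_div_assoc, abs_mul, abs_unit_pow,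
    one_mul]
  gcongr

/-- The generating function of the partial sums is `Li_w(x) / (1 - η x)`. -/
theorem tsum_eulerPartial_succ (η : ℤˣ) (w : List ℤˣ) {x : ℝ} (hx : |x| < 1) :
    ∑' n : ℕ, eulerPartial (unitPairs η w) (n + 1) * (((η : ℤ) : ℝ) * x) ^ n =
      multiPolylog w x / (1 - ((η : ℤ) : ℝ) * x) := by
  have hy : |((η : ℤ) : ℝ) * x| < 1 := by
    have := abs_unit_pow η 1
    rw [pow_one] at this
    rwa [abs_mul, this, one_mul]
  have hne : 1 - ((η : ℤ) : ℝ) * x ≠ 0 := by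
    have := (abs_lt.1 hy).2
    linarith
  set y := ((η : ℤ) : ℝ) * x with hydef
  rcases w with _ | ⟨κ, t⟩
  · simp only [unitPairs, eulerPartial, multiPolylog, one_mul, one_div]
    exact tsum_geometric_of_abs_lt_one hy
  · have hs : Summable fun n : ℕ => eulerPartial (unitPairs η (κ :: t)) (n + 1) * y ^ n := by
      have h1 := summable_pow_mul_geometric_of_norm_lt_one (R := ℝ) 1 (r := |y|) (by simpa using hy)
      have h0 := summable_pow_mul_geometric_of_norm_lt_one (R := ℝ) 0 (r := |y|) (by simpa using hy)
      refine Summable.of_norm_bounded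
        ((h1.add h0).mul_left (3 ^ (unitPairs η (κ :: t)).length)) fun n => ?_
      have := abs_eulerPartial_div_le (unitPairs η (κ :: t)) (n + 1)
      rw [abs_div, Nat.abs_cast, div_le_iff₀ (by positivity)] at this
      rw [Real.norm_eq_abs, abs_mul, abs_pow]
      refine (mul_le_mul_of_nonneg_right this (by positivity)).trans (le_of_eq ?_)
      push_cast
      ring
    have hstep : ∀ n : ℕ, eulerPartial (unitPairs η (κ :: t)) (n + 1) * y ^ n =
        eulerPartial (unitPairs η (κ :: t)) n * y ^ n +
          ((κ : ℤ) : ℝ) ^ n / n * eulerPartial (unitPairs κ t) n * x ^ n := by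
      intro n
      have hη : ((η : ℤ) : ℝ) ^ n * ((η : ℤ) : ℝ) ^ n = 1 := by
        rw [← mul_pow]
        rcases Int.units_eq_one_or η with rfl | rfl <;> simp
      rw [unitPairs, eulerPartial_cons_succ, hydef]
      push_cast
      rw [mul_pow, mul_pow, pow_one]
      linear_combination (((κ : ℤ) : ℝ) ^ n / n * eulerPartial (unitPairs κ t) n * x ^ n) * hη
    have hL := summable_multiPolylog κ t hx
    have hs' : Summable fun n : ℕ => eulerPartial (unitPairs η (κ :: t)) n * y ^ n :=
      (hs.sub hL).congr fun n => by rw [hstep n]; ring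
    have e1 : ∑' n : ℕ, eulerPartial (unitPairs η (κ :: t)) (n + 1) * y ^ n =
        ∑' n : ℕ, eulerPartial (unitPairs η (κ :: t)) n * y ^ n + multiPolylog (κ :: t) x := by
      rw [multiPolylog, ← hs'.tsum_add hL]
      exact tsum_congr hstep
    have e2 : ∑' n : ℕ, eulerPartial (unitPairs η (κ :: t)) n * y ^ n =
        y * ∑' n : ℕ, eulerPartial (unitPairs η (κ :: t)) (n + 1) * y ^ n := by
      rw [hs'.tsum_eq_zero_add, ← tsum_mul_left]
      have : eulerPartial (unitPairs η (κ :: t)) 0 = 0 := by simp [unitPairs, eulerPartial]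
      rw [this, zero_mul, zero_add]
      exact tsum_congr fun n => by ring
    rw [eq_div_iff hne]
    linear_combination e1 + e2

theorem hasDerivAt_multiPolylog (η : ℤˣ) (t : List ℤˣ) {x : ℝ} (hx : |x| < 1) :
    HasDerivAt (multiPolylog (η :: t))
      (((η : ℤ) : ℝ) / (1 - ((η : ℤ) : ℝ) * x) * multiPolylog t x) x := by
  have h := hasDerivAt_tsum_mul_pow
    (a := fun n : ℕ => ((η : ℤ) : ℝ) ^ n / n * eulerPartial (unitPairs η t) n)
    (C := 3 ^ (unitPairs η t).length) (fun n => by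
      rw [div_mul_eq_mul_div, mul_div_assoc, abs_mul, abs_unit_pow, one_mul]
      exact abs_eulerPartial_div_le _ n) hx
  refine h.congr_deriv (Eq.symm ?_)
  rw [div_mul_eq_mul_div, mul_div_assoc, ← tsum_eulerPartial_succ η t hx, ← tsum_mul_left]
  refine tsum_congr fun n => ?_
  push_cast
  have : (n : ℝ) + 1 ≠ 0 := by positivity
  field_simp
  ring

/-- Abel's theorem for the words beginning with `x₋₁`. -/
theorem tendsto_multiPolylog {t : List ℤˣ} {w : Word} (hw : t.map letterOf = w) :
    Tendsto (multiPolylog (-1 :: t)) (𝓝[<] 1) (𝓝 (zetaWord (.xm1 :: w))) := by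
  have e : zetaWord (.xm1 :: w) = eulerZeta ((1, -1) :: unitPairs (-1) t) := by
    have := decode_map_letterOf 1 (-1 :: t)
    rw [List.map_cons, hw, unitPairs, one_mul] at this
    rw [zetaWord, ← this]
    rfl
  rw [e]
  refine Real.tendsto_tsum_powerSeries_nhdsWithin_lt
    ((tendsto_eulerPartial_one_neg_one _).congr fun N => ?_)
  rw [eulerPartial_cons]
  simp

/-! ### The alternating zeta function and an integral -/

/-- `∑_{n ≥ 1} (-1)ⁿ sⁿ / nᵏ = Li_k(-s)`. -/
noncomputable def altPolylog (k : ℕ) (s : ℝ) : ℝ := ∑' n : ℕ, (-1) ^ n / (n : ℝ) ^ k * s ^ n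

theorem altPolylog_one {s : ℝ} (hs : |s| < 1) : altPolylog 1 s = -Real.log (1 + s) := by
  have h := Real.hasSum_pow_div_log_of_abs_lt_one (x := -s) (by rwa [abs_neg])
  have h' : HasSum (fun n : ℕ => (-1 : ℝ) ^ n / (n : ℝ) ^ 1 * s ^ n) (-Real.log (1 + s)) := by
    rw [← hasSum_nat_add_iff' 1]
    simp only [Finset.range_one, Finset.sum_singleton, pow_one, Nat.cast_zero, div_zero, zero_mul,
      sub_zero]
    rw [sub_neg_eq_add] at h
    have e : (fun n : ℕ => (-1 : ℝ) ^ (n + 1) / ((n + 1 : ℕ) : ℝ) * s ^ (n + 1)) =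
        fun n : ℕ => (-s) ^ (n + 1) / ((n : ℝ) + 1) := by
      funext n
      rw [neg_pow]
      push_cast
      ring
    rwa [e]
  exact h'.tsum_eq

theorem abs_altPolylog_coeff_le (k n : ℕ) : |(-1 : ℝ) ^ n / (n : ℝ) ^ (k + 1)| ≤ 1 := by
  rw [abs_div, abs_pow, abs_neg, abs_one, one_pow, abs_pow, Nat.abs_cast]
  rcases Nat.eq_zero_or_pos n with rfl | hn
  · simp
  · exact (div_le_one (by positivity)).2 (one_le_pow₀ (by exact_mod_cast hn))

theorem hasDerivAt_altPolylog (k : ℕ) {s : ℝ} (hs : |s| < 1) (h0 : s ≠ 0) :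
    HasDerivAt (altPolylog (k + 2)) (altPolylog (k + 1) s / s) s := by
  have h := hasDerivAt_tsum_mul_pow (a := fun n : ℕ => (-1 : ℝ) ^ n / (n : ℝ) ^ (k + 2))
    (abs_altPolylog_coeff_le (k + 1)) hs
  refine h.congr_deriv ?_
  have hsum : Summable fun n : ℕ => (-1 : ℝ) ^ n / (n : ℝ) ^ (k + 1) * s ^ n := by
    refine Summable.of_norm_bounded (summable_geometric_of_lt_one (abs_nonneg s) hs) fun n => ?_
    rw [Real.norm_eq_abs, abs_mul, abs_pow s]
    exact mul_le_of_le_one_left (by positivity) (abs_altPolylog_coeff_le k n)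
  rw [altPolylog, hsum.tsum_eq_zero_add, eq_div_iff h0, ← tsum_mul_right]
  simp only [Nat.cast_zero, ne_eq, Nat.add_eq_zero_iff, one_ne_zero, and_false, not_false_eq_true,
    zero_pow, div_zero, zero_mul, zero_add]
  refine tsum_congr fun n => ?_
  push_cast
  have : (n : ℝ) + 1 ≠ 0 := by positivity
  field_simp
  ring

theorem continuousOn_altPolylog (k : ℕ) : ContinuousOn (altPolylog (k + 2)) (Set.Icc (-1) 1) := by
  refine continuousOn_tsum (u := fun n : ℕ => 1 / (n : ℝ) ^ (k + 2)) (fun n => by fun_prop)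
    (Real.summable_one_div_nat_pow.2 (by omega)) fun n s hs => ?_
  rw [Real.norm_eq_abs, abs_mul, abs_div, abs_pow, abs_neg, abs_one, one_pow, abs_pow, Nat.abs_cast,
    abs_pow]
  exact mul_le_of_le_one_right (by positivity) (pow_le_one₀ (abs_nonneg _) (abs_le.2 hs))

theorem altPolylog_zero (k : ℕ) : altPolylog (k + 1) 0 = 0 := by
  rw [altPolylog, ← tsum_zero (α := ℝ) (β := ℕ)]
  refine tsum_congr fun n => ?_
  rcases n with _ | n <;> simp

/-- `∑_{n ≥ 1} (-1)ⁿ / n³ = -3/4 ζ(3)`, from `∑_{n even} 1 / n³ = ζ(3) / 8`. -/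
theorem altPolylog_three_one : altPolylog 3 1 = -(3 / 4 * (riemannZeta 3).re) := by
  have hs : Summable fun n : ℕ => 1 / (n : ℝ) ^ 3 := Real.summable_one_div_nat_pow.2 (by norm_num)
  have hz : (riemannZeta 3).re = ∑' n : ℕ, 1 / (n : ℝ) ^ 3 := by
    have := zeta_nat_eq_tsum_of_gt_one (k := 3) (by norm_num)
    rw [show ((3 : ℕ) : ℂ) = 3 by norm_num] at this
    rw [this, ← Complex.ofReal_re (∑' n : ℕ, 1 / (n : ℝ) ^ 3), Complex.ofReal_tsum]
    push_cast
    rfl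
  have he : Summable fun n : ℕ => 1 / ((2 * n : ℕ) : ℝ) ^ 3 :=
    hs.comp_injective (mul_right_injective₀ two_ne_zero)
  have ho : Summable fun n : ℕ => 1 / ((2 * n + 1 : ℕ) : ℝ) ^ 3 :=
    hs.comp_injective ((add_left_injective 1).comp (mul_right_injective₀ two_ne_zero))
  have h1 := tsum_even_add_odd (f := fun n : ℕ => 1 / (n : ℝ) ^ 3) he ho
  have h8 : ∑' n : ℕ, 1 / ((2 * n : ℕ) : ℝ) ^ 3 = 1 / 8 * ∑' n : ℕ, 1 / (n : ℝ) ^ 3 := by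
    rw [← tsum_mul_left]
    refine tsum_congr fun n => ?_
    push_cast
    rw [mul_pow]
    ring
  have h2 := tsum_even_add_odd (f := fun n : ℕ => (-1 : ℝ) ^ n / (n : ℝ) ^ 3 * 1 ^ n)
    (he.congr fun n => by simp) (ho.neg.congr fun n => by simp [pow_succ, neg_div])
  rw [altPolylog, ← h2, hz]
  have h3 : ∑' n : ℕ, (-1 : ℝ) ^ (2 * n) / ((2 * n : ℕ) : ℝ) ^ 3 * 1 ^ (2 * n) =
      ∑' n : ℕ, 1 / ((2 * n : ℕ) : ℝ) ^ 3 := tsum_congr fun n => by simp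
  have h4 : ∑' n : ℕ, (-1 : ℝ) ^ (2 * n + 1) / ((2 * n + 1 : ℕ) : ℝ) ^ 3 * 1 ^ (2 * n + 1) =
      -∑' n : ℕ, 1 / ((2 * n + 1 : ℕ) : ℝ) ^ 3 := by
    rw [← tsum_neg]
    exact tsum_congr fun n => by simp [pow_succ, neg_div]
  rw [h3, h4]
  linarith

/-- A primitive of `log² s / (2 (1 + s))` on `(0, 1)`. -/
noncomputable def logSqPrimitive (s : ℝ) : ℝ :=
  Real.log s ^ 2 * Real.log (1 + s) / 2 + Real.log s * altPolylog 2 s - altPolylog 3 s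

theorem hasDerivAt_logSqPrimitive {s : ℝ} (h0 : 0 < s) (h1 : s < 1) :
    HasDerivAt logSqPrimitive (Real.log s ^ 2 / (2 * (1 + s))) s := by
  have hs : |s| < 1 := abs_lt.2 ⟨by linarith, h1⟩
  have hl := Real.hasDerivAt_log h0.ne'
  have hl1 : HasDerivAt (fun s => Real.log (1 + s)) (1 / (1 + s)) s :=
    ((hasDerivAt_id s).const_add 1).log (by simp; linarith)
  have := ((((hl.pow 2).mul hl1).div_const 2).add
    (hl.mul (hasDerivAt_altPolylog 0 hs h0.ne'))).sub (hasDerivAt_altPolylog 1 hs h0.ne')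
  refine this.congr_deriv ?_
  simp only [zero_add, one_add_one_eq_two, altPolylog_one hs, Pi.pow_apply]
  have : 1 + s ≠ 0 := by positivity
  field_simp
  push_cast
  ring

theorem logSqPrimitive_one : logSqPrimitive 1 = 3 / 4 * (riemannZeta 3).re := by
  simp [logSqPrimitive, altPolylog_three_one]

theorem continuousWithinAt_logSqPrimitive_one : ContinuousWithinAt logSqPrimitive (Set.Iic 1) 1 := by
  have hc : ∀ k, ContinuousWithinAt (altPolylog (k + 2)) (Set.Iic 1) 1 := fun k =>
    (continuousOn_altPolylog k 1 (by simp)).mono_of_mem_nhdsWithin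
      (Icc_mem_nhdsLE (by norm_num))
  have hl : ContinuousAt Real.log 1 := Real.continuousAt_log one_ne_zero
  have hl1 : ContinuousAt (fun s : ℝ => Real.log (1 + s)) 1 :=
    (by fun_prop : ContinuousAt (fun s : ℝ => 1 + s) 1).log (by norm_num)
  exact ((((hl.pow 2).mul hl1).div_const 2).continuousWithinAt.add
    (hl.continuousWithinAt.mul (hc 0))).sub (hc 1)

theorem tendsto_logSqPrimitive_zero : Tendsto logSqPrimitive (𝓝[>] 0) (𝓝 0) := by
  have hlog : Tendsto (fun s : ℝ => Real.log s * s) (𝓝[>] 0) (𝓝 0) := by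
    simpa using tendsto_log_mul_rpow_nhdsGT_zero (r := 1) one_pos
  have hlog2 : Tendsto (fun s : ℝ => Real.log s ^ 2 * s) (𝓝[>] 0) (𝓝 0) := by
    have := (tendsto_log_mul_rpow_nhdsGT_zero (r := 1 / 2) (by norm_num)).pow 2
    rw [zero_pow two_ne_zero] at this
    refine this.congr' ?_
    filter_upwards [self_mem_nhdsWithin] with s hs
    have hs' : (0 : ℝ) < s := hs
    rw [mul_pow, ← Real.sqrt_eq_rpow, Real.sq_sqrt hs'.le]
  -- differentiability at `0` controls `log (1 + s) / s` and `Li₂(-s) / s`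
  have hq : ∀ {f : ℝ → ℝ} {c : ℝ}, HasDerivAt f c 0 → f 0 = 0 →
      Tendsto (fun s => f s / s) (𝓝[>] 0) (𝓝 c) := by
    intro f c hf h0
    have := (hasDerivAt_iff_tendsto_slope.1 hf).mono_left
      (nhdsWithin_mono 0 fun s (hs : 0 < s) => hs.ne')
    refine this.congr fun s => ?_
    simp [slope_def_field, h0]
  have h1 : HasDerivAt (fun s : ℝ => Real.log (1 + s)) (1 / (1 + 0)) 0 :=
    ((hasDerivAt_id (0 : ℝ)).const_add 1).log (by simp)
  have h2 := hasDerivAt_tsum_mul_pow (a := fun n : ℕ => (-1 : ℝ) ^ n / (n : ℝ) ^ 2)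
    (abs_altPolylog_coeff_le 1) (x := 0) (by simp)
  have h3 : Tendsto (altPolylog 3) (𝓝[>] 0) (𝓝 0) := by
    have := (continuousOn_altPolylog 1).continuousAt
      (Icc_mem_nhds (by norm_num : (-1 : ℝ) < 0) one_pos)
    have := this.tendsto.mono_left (nhdsWithin_le_nhds (s := Set.Ioi 0))
    rwa [altPolylog_zero 2] at this
  have := (((hlog2.mul (hq h1 (by simp))).div_const 2).add
    (hlog.mul (hq h2 (altPolylog_zero 1)))).sub h3
  simp only [zero_mul, zero_div, add_zero, sub_zero] at this
  refine this.congr' ?_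
  filter_upwards [self_mem_nhdsWithin] with s hs
  have hs' : s ≠ 0 := (show (0 : ℝ) < s from hs).ne'
  rw [logSqPrimitive]
  have e : altPolylog 2 s = ∑' n : ℕ, (-1 : ℝ) ^ n / (n : ℝ) ^ 2 * s ^ n := rfl
  rw [← e]
  field_simp

/-! ### The values `T(1, …, 1)` and `S(1, …, 1)` as combinations of words -/

theorem sum_fin_succ_units {n : ℕ} {M : Type*} [AddCommMonoid M] (f : (Fin (n + 1) → ℤˣ) → M) :
    ∑ σ, f σ = ∑ σ : Fin n → ℤˣ, (f (Fin.cons 1 σ) + f (Fin.cons (-1) σ)) := by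
  rw [← (Fin.consEquiv fun _ => ℤˣ).sum_comp, Fintype.sum_prod_type, UnitsInt.univ,
    Finset.sum_pair (by decide), ← Finset.sum_add_distrib]
  rfl

theorem zetaShWord_nil : zetaShWord [] = 1 := by
  have h : eulerZeta [] = 1 :=
    (tendsto_const_nhds : Filter.Tendsto (fun _ : ℕ => (1 : ℝ)) Filter.atTop (nhds 1)).limUnder_eq
  rw [zetaShWord_admissible [] (by simp), zetaWord, decode, h, C_1]

theorem regValue_nil (F : Kind) : regValue F [] = 1 := by
  cases F <;> simp [regValue, Kind.sign, zetaSh, encode, zetaShWord_nil]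

theorem regValue_T_one : regValue .T [1] =
    C (1 / 2) * (zetaShWord [.x1] - zetaShWord [.xm1]) := by
  unfold regValue
  simp only [List.length_cons, List.length_nil, sum_fin_succ_units]
  simp [Kind.sign, zetaSh, encode, letterOf, List.ofFn_succ]
  ring

theorem regValue_S_one : regValue .S [1] =
    C (1 / 2) * (zetaShWord [.x1] + zetaShWord [.xm1]) := by
  unfold regValue
  simp only [List.length_cons, List.length_nil, sum_fin_succ_units]
  simp [Kind.sign, zetaSh, encode, letterOf, List.ofFn_succ]

theorem regValue_T_one_one : regValue .T [1, 1] =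
    C (1 / 4) * (zetaShWord [.x1, .x1] - zetaShWord [.x1, .xm1] - zetaShWord [.xm1, .x1]
      + zetaShWord [.xm1, .xm1]) := by
  unfold regValue
  simp only [List.length_cons, List.length_nil, sum_fin_succ_units]
  simp [Kind.sign, Fin.prod_univ_succ, zetaSh, encode, letterOf, List.ofFn_succ]
  norm_num
  ring

theorem regValue_S_one_one : regValue .S [1, 1] =
    C (1 / 4) * (zetaShWord [.x1, .x1] + zetaShWord [.x1, .xm1] - zetaShWord [.xm1, .x1]
      - zetaShWord [.xm1, .xm1]) := by
  unfold regValue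
  simp only [List.length_cons, List.length_nil, sum_fin_succ_units]
  simp [Kind.sign, Fin.prod_univ_succ, zetaSh, encode, letterOf, List.ofFn_succ]
  norm_num
  ring

theorem regValue_T_one_one_one : regValue .T [1, 1, 1] =
    C (1 / 8) * (zetaShWord [.x1, .x1, .x1] - zetaShWord [.x1, .x1, .xm1]
      - zetaShWord [.x1, .xm1, .x1] + zetaShWord [.x1, .xm1, .xm1]
      - zetaShWord [.xm1, .x1, .x1] + zetaShWord [.xm1, .x1, .xm1]
      + zetaShWord [.xm1, .xm1, .x1] - zetaShWord [.xm1, .xm1, .xm1]) := by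
  unfold regValue
  simp only [List.length_cons, List.length_nil, sum_fin_succ_units]
  simp [Kind.sign, Fin.prod_univ_succ, zetaSh, encode, letterOf, List.ofFn_succ]
  norm_num
  ring

theorem regValue_S_one_one_one : regValue .S [1, 1, 1] =
    C (1 / 8) * (zetaShWord [.x1, .x1, .x1] + zetaShWord [.x1, .x1, .xm1]
      - zetaShWord [.x1, .xm1, .x1] - zetaShWord [.x1, .xm1, .xm1]
      - zetaShWord [.xm1, .x1, .x1] - zetaShWord [.xm1, .x1, .xm1]
      + zetaShWord [.xm1, .xm1, .x1] + zetaShWord [.xm1, .xm1, .xm1]) := by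
  unfold regValue
  simp only [List.length_cons, List.length_nil, sum_fin_succ_units]
  simp [Kind.sign, Fin.prod_univ_succ, zetaSh, encode, letterOf, List.ofFn_succ,
    show ¬ Odd 2 by decide]
  norm_num
  ring

theorem symValue_one_one_one (F : Kind) : symValue F [1, 1, 1] =
    regValue F [1, 1, 1] - regValue F.swap [1] * regValue F [1, 1]
      + regValue F.swap [1, 1] * regValue F [1] - regValue F.swap [1, 1, 1] := by
  simp [symValue, Finset.sum_range_succ, show ¬ Even 3 by decide, regValue_nil]
  ring

/-! ### Identities between multiple polylogarithms -/

theorem hasDerivAt_multiPolylog_one (t : List ℤˣ) {x : ℝ} (hx : |x| < 1) :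
    HasDerivAt (multiPolylog (1 :: t)) (multiPolylog t x / (1 - x)) x := by
  refine (hasDerivAt_multiPolylog 1 t hx).congr_deriv ?_
  simp
  ring

theorem hasDerivAt_multiPolylog_neg_one (t : List ℤˣ) {x : ℝ} (hx : |x| < 1) :
    HasDerivAt (multiPolylog (-1 :: t)) (-multiPolylog t x / (1 + x)) x := by
  refine (hasDerivAt_multiPolylog (-1) t hx).congr_deriv ?_
  simp
  ring

theorem eq_of_hasDerivAt_eq {f g f' : ℝ → ℝ} (hf : ∀ x, |x| < 1 → HasDerivAt f (f' x) x)
    (hg : ∀ x, |x| < 1 → HasDerivAt g (f' x) x) (h0 : f 0 = g 0) {x : ℝ} (hx : |x| < 1) :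
    f x = g x := by
  have hd : ∀ y ∈ Metric.ball (0 : ℝ) 1, HasDerivAt (fun y => f y - g y) 0 y := fun y hy => by
    have hy' : |y| < 1 := by simpa using hy
    exact ((hf y hy').sub (hg y hy')).congr_deriv (sub_self _)
  have := Metric.isOpen_ball.is_const_of_deriv_eq_zero (convex_ball (0 : ℝ) 1).isPreconnected
    (fun y hy => (hd y hy).differentiableAt.differentiableWithinAt) (fun y hy => (hd y hy).deriv)
    (show x ∈ Metric.ball (0 : ℝ) 1 by simpa using hx) (Metric.mem_ball_self one_pos)
  rwa [h0, sub_self, sub_eq_zero] at this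

/-- The shuffle product `x₋₁ ⧢ x₋₁x₁ = 2 x₋₁x₋₁x₁ + x₋₁x₁x₋₁`. -/
theorem multiPolylog_mul_shuffle {x : ℝ} (hx : |x| < 1) :
    multiPolylog [-1] x * multiPolylog [-1, 1] x =
      2 * multiPolylog [-1, -1, 1] x + multiPolylog [-1, 1, -1] x := by
  have hprod : ∀ x, |x| < 1 → multiPolylog [-1] x * multiPolylog [1] x =
      multiPolylog [-1, 1] x + multiPolylog [1, -1] x := fun x hx =>
    eq_of_hasDerivAt_eq
      (fun y hy => (hasDerivAt_multiPolylog_neg_one [] hy).mul (hasDerivAt_multiPolylog_one [] hy))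
      (fun y hy => ((hasDerivAt_multiPolylog_neg_one [1] hy).add
        (hasDerivAt_multiPolylog_one [-1] hy)).congr_deriv (by simp only [multiPolylog]; ring))
      (by simp [multiPolylog_zero]) hx
  refine eq_of_hasDerivAt_eq
    (fun y hy => (hasDerivAt_multiPolylog_neg_one [] hy).mul
      (hasDerivAt_multiPolylog_neg_one [1] hy))
    (fun y hy => (((hasDerivAt_multiPolylog_neg_one [-1, 1] hy).const_mul 2).add
      (hasDerivAt_multiPolylog_neg_one [1, -1] hy)).congr_deriv ?_)
    (by simp [multiPolylog_zero]) hx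
  have h1 : multiPolylog [] y = 1 := rfl
  rw [h1]
  linear_combination (1 / (1 + y)) * hprod y hy

theorem multiPolylog_one_sub_neg_one {x : ℝ} (hx : |x| < 1) :
    multiPolylog [1] x - multiPolylog [-1] x = -Real.log ((1 - x) / (1 + x)) := by
  obtain ⟨hx1, hx2⟩ := abs_lt.1 hx
  rw [Real.log_div (by linarith) (by linarith), neg_sub]
  refine eq_of_hasDerivAt_eq
    (fun y hy => (hasDerivAt_multiPolylog_one [] hy).sub (hasDerivAt_multiPolylog_neg_one [] hy))
    (g := fun x => Real.log (1 + x) - Real.log (1 - x)) (fun y hy => ?_)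
    (by simp [multiPolylog_zero]) hx
  obtain ⟨hy1, hy2⟩ := abs_lt.1 hy
  refine ((((hasDerivAt_id y).const_add 1).log (by simp; linarith)).sub
    (((hasDerivAt_id y).const_sub 1).log (by simp; linarith))).congr_deriv ?_
  simp only [multiPolylog, id]
  ring

/-- The shuffle product `y ⧢ y = 2 y y` for `y = x₁ - x₋₁`. -/
theorem sq_multiPolylog_one_sub_neg_one {x : ℝ} (hx : |x| < 1) :
    (multiPolylog [1] x - multiPolylog [-1] x) ^ 2 =
      2 * (multiPolylog [1, 1] x - multiPolylog [1, -1] x - multiPolylog [-1, 1] x +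
        multiPolylog [-1, -1] x) := by
  refine eq_of_hasDerivAt_eq
    (fun y hy => ((hasDerivAt_multiPolylog_one [] hy).sub
      (hasDerivAt_multiPolylog_neg_one [] hy)).pow 2)
    (fun y hy => (((((hasDerivAt_multiPolylog_one [1] hy).sub
      (hasDerivAt_multiPolylog_one [-1] hy)).sub (hasDerivAt_multiPolylog_neg_one [1] hy)).add
      (hasDerivAt_multiPolylog_neg_one [-1] hy)).const_mul 2).congr_deriv ?_)
    (by simp [multiPolylog_zero]) hx
  simp only [multiPolylog, Pi.sub_apply]
  push_cast
  ring

/-! ### Values at `1` -/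

theorem zetaWord_mul_shuffle :
    zetaWord [.xm1] * zetaWord [.xm1, .x1] =
      2 * zetaWord [.xm1, .xm1, .x1] + zetaWord [.xm1, .x1, .xm1] := by
  refine tendsto_nhds_unique_of_eventuallyEq
    ((tendsto_multiPolylog (t := []) (w := []) rfl).mul
      (tendsto_multiPolylog (t := [1]) (w := [.x1]) (by simp [letterOf])))
    (((tendsto_multiPolylog (t := [-1, 1]) (w := [.xm1, .x1]) (by simp [letterOf])).const_mul 2).add
      (tendsto_multiPolylog (t := [1, -1]) (w := [.x1, .xm1]) (by simp [letterOf]))) ?_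
  filter_upwards [Ioo_mem_nhdsLT (zero_lt_one' ℝ)] with x hx
  exact multiPolylog_mul_shuffle (abs_lt.2 ⟨by linarith [hx.1], hx.2⟩)

/-- The value of `ζ(x₋₁ y y)` for `y = x₁ - x₋₁`. The substitution `s = (1 - t) / (1 + t)` turns
`-∫₀¹ log²((1 + t) / (1 - t)) / (2 (1 + t)) dt` into `-∫₀¹ log² s / (2 (1 + s)) ds`. -/
theorem zetaWord_xm1_sub_sub :
    zetaWord [.xm1, .x1, .x1] - zetaWord [.xm1, .x1, .xm1] - zetaWord [.xm1, .xm1, .x1] +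
      zetaWord [.xm1, .xm1, .xm1] = -(3 / 4 * (riemannZeta 3).re) := by
  set G : ℝ → ℝ := fun x => multiPolylog [-1, 1, 1] x - multiPolylog [-1, 1, -1] x -
    multiPolylog [-1, -1, 1] x + multiPolylog [-1, -1, -1] x with hG
  have hGd : ∀ x, |x| < 1 →
      HasDerivAt G (-(Real.log ((1 - x) / (1 + x))) ^ 2 / (2 * (1 + x))) x := by
    intro x hx
    refine ((((hasDerivAt_multiPolylog_neg_one [1, 1] hx).sub
      (hasDerivAt_multiPolylog_neg_one [1, -1] hx)).sub
      (hasDerivAt_multiPolylog_neg_one [-1, 1] hx)).add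
      (hasDerivAt_multiPolylog_neg_one [-1, -1] hx)).congr_deriv ?_
    have h := sq_multiPolylog_one_sub_neg_one hx
    rw [multiPolylog_one_sub_neg_one hx, neg_sq] at h
    rw [h]
    have : 1 + x ≠ 0 := by linarith [(abs_lt.1 hx).1]
    field_simp
    ring
  have hd : ∀ x ∈ Set.Ioo (0 : ℝ) 1,
      HasDerivAt (fun x => G x - logSqPrimitive ((1 - x) / (1 + x))) 0 x := by
    intro x hx
    have h1 : 0 < 1 + x := by linarith [hx.1]
    have h2 : 0 < 1 - x := by linarith [hx.2]
    have hs : HasDerivAt (fun x : ℝ => (1 - x) / (1 + x)) (-2 / (1 + x) ^ 2) x :=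
      (((hasDerivAt_id x).const_sub 1).div ((hasDerivAt_id x).const_add 1) h1.ne').congr_deriv
        (by simp only [id]; ring)
    refine ((hGd x (abs_lt.2 ⟨by linarith [hx.1], hx.2⟩)).sub
      ((hasDerivAt_logSqPrimitive (by positivity)
        ((div_lt_one h1).2 (by linarith [hx.1]))).comp x hs)).congr_deriv ?_
    have e : 1 + (1 - x) / (1 + x) = 2 / (1 + x) := by field_simp; ring
    rw [e]
    field_simp
    ring
  have hconst : ∀ x ∈ Set.Ioo (0 : ℝ) 1, G x - logSqPrimitive ((1 - x) / (1 + x)) =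
      G (1 / 2) - logSqPrimitive ((1 - 1 / 2) / (1 + 1 / 2)) := fun x hx =>
    isOpen_Ioo.is_const_of_deriv_eq_zero isPreconnected_Ioo
      (fun y hy => (hd y hy).differentiableAt.differentiableWithinAt) (fun y hy => (hd y hy).deriv)
      hx (by norm_num)
  set c := G (1 / 2) - logSqPrimitive ((1 - 1 / 2) / (1 + 1 / 2))
  have hcont : ∀ x : ℝ, 0 ≤ x → ContinuousAt (fun x : ℝ => (1 - x) / (1 + x)) x := fun x hx =>
    ContinuousAt.div (by fun_prop) (by fun_prop) (by positivity)
  -- as `t → 0`, the constant is `-logSqPrimitive 1`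
  have h0 : c = -(3 / 4 * (riemannZeta 3).re) := by
    have hs : Tendsto (fun x : ℝ => (1 - x) / (1 + x)) (𝓝[>] 0) (𝓝[≤] 1) := by
      refine tendsto_nhdsWithin_iff.2 ⟨?_, ?_⟩
      · simpa using (hcont 0 le_rfl).tendsto.mono_left (nhdsWithin_le_nhds (s := Set.Ioi 0))
      · filter_upwards [self_mem_nhdsWithin] with x hx
        have hx' : (0 : ℝ) < x := hx
        change (1 - x) / (1 + x) ≤ 1
        exact (div_le_one (by positivity)).2 (by linarith)
    have hF := continuousWithinAt_logSqPrimitive_one.tendsto.comp hs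
    have hG0 : Tendsto G (𝓝[>] 0) (𝓝 0) := by
      have := (hGd 0 (by simp)).continuousAt.tendsto.mono_left (nhdsWithin_le_nhds (s := Set.Ioi 0))
      simpa [hG, multiPolylog_zero] using this
    rw [logSqPrimitive_one] at hF
    have := tendsto_nhds_unique_of_eventuallyEq (tendsto_const_nhds (x := c)) (hG0.sub hF) (by
      filter_upwards [Ioo_mem_nhdsGT (zero_lt_one' ℝ)] with x hx
      exact (hconst x hx).symm)
    rw [this, zero_sub]
  -- as `t → 1`, the constant is the limit of `G`
  have hs : Tendsto (fun x : ℝ => (1 - x) / (1 + x)) (𝓝[<] 1) (𝓝[>] 0) := by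
    refine tendsto_nhdsWithin_iff.2 ⟨?_, ?_⟩
    · simpa using (hcont 1 zero_le_one).tendsto.mono_left (nhdsWithin_le_nhds (s := Set.Iio 1))
    · filter_upwards [Ioo_mem_nhdsLT (zero_lt_one' ℝ)] with x hx
      change 0 < (1 - x) / (1 + x)
      exact div_pos (by linarith [hx.2]) (by linarith [hx.1])
  have hG1 := (((tendsto_multiPolylog (t := [1, 1]) (w := [.x1, .x1]) (by simp [letterOf])).sub
    (tendsto_multiPolylog (t := [1, -1]) (w := [.x1, .xm1]) (by simp [letterOf]))).sub
    (tendsto_multiPolylog (t := [-1, 1]) (w := [.xm1, .x1]) (by simp [letterOf]))).add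
    (tendsto_multiPolylog (t := [-1, -1]) (w := [.xm1, .xm1]) (by simp [letterOf]))
  have := tendsto_nhds_unique_of_eventuallyEq
    (hG1.sub (tendsto_logSqPrimitive_zero.comp hs)) (tendsto_const_nhds (x := c)) (by
      filter_upwards [Ioo_mem_nhdsLT (zero_lt_one' ℝ)] with x hx
      exact hconst x hx)
  rw [sub_zero, h0] at this
  exact this

/-! ### The symmetric values -/

/-- `T^S(1, 1, 1)` is `1 / 4` of the left-hand side: with `a = x₁` and `b = x₋₁`, the products in
`T^S(1, 1, 1)` add up to the first two lines, and `T(1, 1, 1) - S(1, 1, 1)` to the other two. By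
shuffle products it equals `-ζ(b (a - b) (a - b))`, which is free of `X`. -/
theorem zetaShWord_symmetric_sum :
    (zetaShWord [.xm1] * (zetaShWord [.xm1, .x1] - zetaShWord [.x1, .x1]) +
      zetaShWord [.x1] * (zetaShWord [.x1, .xm1] - zetaShWord [.xm1, .xm1])) -
      (zetaShWord [.x1, .x1, .xm1] - zetaShWord [.x1, .xm1, .xm1]
        - zetaShWord [.xm1, .x1, .xm1] + zetaShWord [.xm1, .xm1, .xm1]) =
      C (3 / 4 * (riemannZeta 3).re) := by
  have ra := zetaShWord_shuffle []
  have raa := zetaShWord_shuffle [.x1]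
  have rb := zetaShWord_shuffle [.xm1]
  have rab := zetaShWord_shuffle [.x1, .xm1]
  have rba := zetaShWord_shuffle [.xm1, .x1]
  have rbb := zetaShWord_shuffle [.xm1, .xm1]
  simp only [shuffle, List.map_cons, List.map_nil, List.cons_append, List.nil_append,
    List.sum_cons, List.sum_nil, add_zero, zetaShWord_nil, mul_one] at ra raa rb rab rba rbb
  have h1 := congrArg C zetaWord_mul_shuffle
  have h2 := congrArg C zetaWord_xm1_sub_sub
  simp only [C_mul, C_add, C_sub, C_neg, ← zetaShWord_admissible (.xm1 :: _) (by simp), C_ofNat]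
    at h1 h2
  have hbaa : zetaShWord [.xm1] * zetaShWord [.x1, .x1] =
      zetaShWord [.xm1, .x1, .x1] + zetaShWord [.x1, .xm1, .x1] +
        zetaShWord [.x1, .x1, .xm1] := by
    refine mul_left_cancel₀ (two_ne_zero (α := ℝ[X])) ?_
    linear_combination zetaShWord [.xm1] * raa + X * zetaShWord [.xm1] * ra - X * rb - rab - rba
  rw [C_mul]
  linear_combination h1 - hbaa + (zetaShWord [.x1, .xm1] - zetaShWord [.xm1, .xm1]) * ra - rab +
    rbb - h2

end SymMTV

theorem mainTheorem9 :
    SymMTV.symValue .T [1, 1, 1] = - SymMTV.symValue .S [1, 1, 1] ∧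
      - SymMTV.symValue .S [1, 1, 1] = Polynomial.C (3 / 16 * (riemannZeta 3).re) := by
  have key := SymMTV.zetaShWord_symmetric_sum
  have h24 : (Polynomial.C (1 / 2) * Polynomial.C (1 / 4) : Polynomial ℝ) =
      Polynomial.C (1 / 8) := by
    rw [← Polynomial.C_mul]; norm_num
  have h8 : (Polynomial.C (3 / 16 * (riemannZeta 3).re) : Polynomial ℝ) =
      2 * Polynomial.C (1 / 8) * Polynomial.C (3 / 4 * (riemannZeta 3).re) := by
    rw [← Polynomial.C_ofNat, ← Polynomial.C_mul, ← Polynomial.C_mul]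
    congr 1
    ring
  rw [h8, SymMTV.symValue_one_one_one, SymMTV.symValue_one_one_one]
  simp only [SymMTV.Kind.swap, SymMTV.regValue_T_one, SymMTV.regValue_S_one,
    SymMTV.regValue_T_one_one, SymMTV.regValue_S_one_one, SymMTV.regValue_T_one_one_one,
    SymMTV.regValue_S_one_one_one]
  constructor
  · ring
  · rw [← key, ← h24]
    ring
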